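/- **Theorem (kernel of $X^2$ in the plane).** Let $\mathcal S(E^2(2))$ be the space of elastic $2$-tensor fields on $\mathbb R^2$ with Schwartz components, i.e. real tensor fields $f=(f_{ijk\ell})_{1\le i,j,k,\ell\le 2}$ with $f_{ijk\ell}\in\mathcal S(\mathbb R^2)$ and $f_{ijk\ell}=f_{jik\ell}=f_{ij\ell k}=f_{k\ell ij}$. For such $f$ put $$X^2f(x,\xi,\zeta)=\int_{\mathbb R}\sum_{i,j,k,\ell} f_{ijk\ell}(x+t\xi)\,\xi_i\zeta_j\xi_k\zeta_\ell\,dt ,\qquad x,\xi,\zeta\in\mathbb R^2,\ |\xi|=1,\ \zeta\in\mathbb R\xi\cup\xi^\perp .$$ For a smooth elastic $1$-tensor field $v\in C^\infty(E^1(2))$ (a smooth symmetric $2$-tensor field, $v_{ij}=v_{ji}$) and a vector field $u$ put $$(Hv)_{ijk\ell}=\tfrac12\big(\partial_i\partial_j v_{k\ell}+\partial_k\partial_\ell v_{ij}\big),\qquad (Ku)_{ijk\ell}=\tfrac14(\partial_i u_j+\partial_j u_i)\,\delta_{k\ell}+\tfrac14(\partial_k u_\ell+\partial_\ell u_k)\,\delta_{ij}.$$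 Let $N\in\{1,2,\dots\}\cup\{\infty\}$. Then, for every $f\in\mathcal S(E^2(2))$, $$X^2f=0\quad\Longleftrightarrow\quad f=Hv+Ku\ \text{ for some } v\in C^\infty(E^1(2)) \text{ and } u\in\mathcal S(\mathbb R^2;\mathbb R^2)$$ such that $v$, $u$ and their partial derivatives of all orders at most $N$ tend to $0$ as $|x|\to\infty$. -/

import Mathlib

open scoped SchwartzMap

noncomputable section

/-- The Euclidean space `ℝⁿ`. -/
abbrev Euc (n : ℕ) : Type := EuclideanSpace ℝ (Fin n)

/-- The partial derivative `∂g/∂xᵢ`. -/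
def partialD {n : ℕ} (i : Fin n) (g : Euc n → ℝ) : Euc n → ℝ :=
  fun x => fderiv ℝ g x (EuclideanSpace.single i 1)

/-- The space `𝓢(E²(n))` of Schwartz elastic 2-tensor fields: 4-tensor fields with Schwartz
components, symmetric in the first two and in the last two indices, and invariant under
exchanging these two pairs. -/
structure SchwartzElastic2 (n : ℕ) where
  comp : Fin n → Fin n → Fin n → Fin n → 𝓢(Euc n, ℝ)
  symm_left : ∀ i j k l, comp i j k l = comp j i k l
  symm_right : ∀ i j k l, comp i j k l = comp i j l k
  symm_block : ∀ i j k l, comp i j k l = comp k l i j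

/-- The space `C^∞(E¹(n)) = C^∞(S²(ℝⁿ))` of smooth elastic 1-tensor fields. -/
structure SmoothElastic1 (n : ℕ) where
  comp : Fin n → Fin n → Euc n → ℝ
  smooth : ∀ i j, ContDiff ℝ (⊤ : ℕ∞) (comp i j)
  symm : ∀ i j, comp i j = comp j i

/-- The space `𝓢(S¹(ℝⁿ))` of Schwartz vector fields, given by their components. -/
abbrev SchwartzVectorField (n : ℕ) : Type := Fin n → 𝓢(Euc n, ℝ)

/-- The set `𝒵` of pairs `(ξ, ζ)` with `ξ` a unit vector and `ζ ∈ ℝξ ∪ ξ^⊥`. -/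
def polarizationPairs (n : ℕ) : Set (Euc n × Euc n) :=
  {p | ‖p.1‖ = 1 ∧ (p.2 ∈ Submodule.span ℝ {p.1} ∨ p.2 ∈ (Submodule.span ℝ {p.1})ᗮ)}

/-- The elastic ray transform
`X² f (x, ξ, ζ) = ∫ ⟨f(x + tξ), (ξ ⊗ ζ)^{⊗2}⟩ dt`, a function on `ℝⁿ × 𝒵`. -/
def elasticRayTransform2 {n : ℕ} (f : SchwartzElastic2 n) :
    Euc n × polarizationPairs n → ℝ :=
  fun p =>
    let x : Euc n := p.1
    let ξ : Euc n := p.2.1.1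
    let ζ : Euc n := p.2.1.2
    ∫ t : ℝ, ∑ i, ∑ j, ∑ k, ∑ l, f.comp i j k l (x + t • ξ) * (ξ i * ζ j * ξ k * ζ l)

/-- `(Hv)_{ijkl} = ½ (∂ᵢ∂ⱼ v_{kl} + ∂ₖ∂ₗ v_{ij})`. -/
def opH {n : ℕ} (v : Fin n → Fin n → Euc n → ℝ) (i j k l : Fin n) : Euc n → ℝ :=
  fun x => (1 / 2 : ℝ) *
    (partialD i (partialD j (v k l)) x + partialD k (partialD l (v i j)) x)

/-- `(Ku)_{ijkl} = ¼ (∂ᵢuⱼ + ∂ⱼuᵢ) δ_{kl} + ¼ (∂ₖuₗ + ∂ₗuₖ) δ_{ij}`. -/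
def opK {n : ℕ} (u : Fin n → Euc n → ℝ) (i j k l : Fin n) : Euc n → ℝ :=
  fun x =>
    (1 / 4 : ℝ) * (partialD i (u j) x + partialD j (u i) x) * (if k = l then 1 else 0) +
    (1 / 4 : ℝ) * (partialD k (u l) x + partialD l (u k) x) * (if i = j then 1 else 0)

/-- `g` and all its derivatives of order at most `N` tend to `0` as `|x| → ∞`. -/
def VanishesAtInfinity {n : ℕ} (N : ℕ∞) (g : Euc n → ℝ) : Prop :=
  ∀ m : ℕ, (m : ℕ∞) ≤ N →
    Filter.Tendsto (fun x => ‖iteratedFDeriv ℝ m g x‖) (Filter.cocompact (Euc n)) (nhds 0)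

end

open scoped SchwartzMap FourierTransform LineDeriv
open MeasureTheory Filter Topology

noncomputable section

/-! Potentials lie in the kernel because on a line the integrand of `Hv + Ku` is a derivative. The
symmetrised gradient of `u` differs from the full one by a curl term carrying the factor (ξ·ζ)(ξ₀ζ₁
- ξ₁ζ₀), which vanishes for admissible ζ. The primitive involves `u` and first derivatives of `v`,
so decay with `1 ≤ N` suffices.

Conversely, by a Fourier slice argument (`fourier_eq_zero_of_line_integrals`), X²f = 0 says that
f̂(k), contracted with ξ⊗ζ⊗ξ⊗ζ, vanishes whenever ξ ⊥ k. In the plane ξ is then parallel to `rot k`,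
and taking ζ parallel to `rot k` or to k leaves two polynomial relations among the six components of
f̂. `exists_potentials_of_symbol_eq` solves them by restricting to coordinate axes, reading off
divisibility, and dividing. Each quotient stays Schwartz by `SchwartzMap.exists_eq_coord_smul`.
Inverting the Fourier transform and taking real parts gives Schwartz potentials, which decay to
every order. -/

namespace SchwartzMap

/-! ### Division of Schwartz functions by a coordinate -/

variable {n : ℕ} {F : Type} [NormedAddCommGroup F] [NormedSpace ℝ F]

/-- The rank-one map `x ↦ xᵢ eᵢ`. -/
def coordProj (i : Fin n) : Euc n →L[ℝ] Euc n :=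
  (EuclideanSpace.proj i : Euc n →L[ℝ] ℝ).smulRight (EuclideanSpace.single i 1)

theorem coordProj_apply (i : Fin n) (x : Euc n) :
    coordProj i x = x i • EuclideanSpace.single i (1 : ℝ) := rfl

/-- The contraction `x ↦ x - (1 - t) xᵢ eᵢ` onto the hyperplane `xᵢ = 0` at `t = 0`. -/
def coordContract (i : Fin n) (t : ℝ) : Euc n →L[ℝ] Euc n :=
  ContinuousLinearMap.id ℝ _ - (1 - t) • coordProj i

theorem coordContract_apply (i : Fin n) (t : ℝ) (x : Euc n) :
    coordContract i t x = x - (1 - t) • coordProj i x := rfl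

theorem norm_coordProj_apply (i : Fin n) (x : Euc n) : ‖coordProj i x‖ = |x i| := by
  rw [coordProj_apply, norm_smul]; simp

theorem norm_coordProj_le (i : Fin n) : ‖coordProj i‖ ≤ 1 := by
  refine ContinuousLinearMap.opNorm_le_bound _ zero_le_one fun x => ?_
  rw [norm_coordProj_apply, one_mul, ← Real.norm_eq_abs]
  exact PiLp.norm_apply_le x i

theorem continuous_coordContract (i : Fin n) (x : Euc n) :
    Continuous fun t => coordContract i t x := by
  simp only [coordContract_apply]; fun_prop

theorem continuous_coordContract_clm (i : Fin n) : Continuous fun t => coordContract i t := by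
  unfold coordContract; fun_prop

/-- The weighted average of `G` along the segments from `x` to the hyperplane `xᵢ = 0`. -/
def segAverage (i : Fin n) (j : ℕ) (G : 𝓢(Euc n, F)) (x : Euc n) : F :=
  ∫ t in (0 : ℝ)..1, (1 - t) ^ j • G (coordContract i t x)

/-- Precomposition of the derivative of `G` with the projection onto the `i`-th axis. -/
def fderivProj (i : Fin n) (G : 𝓢(Euc n, F)) : 𝓢(Euc n, Euc n →L[ℝ] F) :=
  (fderivCLM ℝ (Euc n) F G).postcompCLM
    ((ContinuousLinearMap.compL ℝ (Euc n) (Euc n) F).flip (coordProj i))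

theorem fderivProj_apply (i : Fin n) (G : 𝓢(Euc n, F)) (x : Euc n) :
    fderivProj i G x = (fderiv ℝ G x).comp (coordProj i) := rfl

theorem weight_le_one {t : ℝ} (ht : t ∈ Set.uIoc (0 : ℝ) 1) (j : ℕ) : ‖(1 - t) ^ j‖ ≤ 1 := by
  rw [Set.uIoc_of_le zero_le_one] at ht
  rw [norm_pow, Real.norm_eq_abs, abs_of_nonneg (by linarith [ht.2])]
  exact pow_le_one₀ (by linarith [ht.2]) (by linarith [ht.1])

theorem weight_continuous (j : ℕ) : Continuous fun t : ℝ => (1 - t) ^ j := by fun_prop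

/-- The contraction is the identity minus (1 - t) times the projection, so the chain rule yields two
terms, the second raising the weight exponent. Segment averages are thus closed under
differentiation once `j` and the target space vary, which is what permits induction on the order. -/
theorem hasFDerivAt_segAverage [CompleteSpace F] (i : Fin n) (j : ℕ) (G : 𝓢(Euc n, F))
    (x : Euc n) :
    HasFDerivAt (segAverage i j G)
      (segAverage i j (fderivCLM ℝ (Euc n) F G) x - segAverage i (j + 1) (fderivProj i G) x)
      x := by
  have hG' : Continuous fun y => fderiv ℝ G y := (fderivCLM ℝ (Euc n) F G).continuous
  set C := SchwartzMap.seminorm ℝ 0 0 (fderivCLM ℝ (Euc n) F G) with hC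
  have key := intervalIntegral.hasFDerivAt_integral_of_dominated_of_fderiv_le
    (𝕜 := ℝ) (μ := volume) (a := 0) (b := 1) (x₀ := x) (s := Set.univ)
    (F := fun y t => (1 - t) ^ j • G (coordContract i t y))
    (F' := fun y t => (1 - t) ^ j • (fderiv ℝ G (coordContract i t y)).comp (coordContract i t))
    (bound := fun _ => C * 2) Filter.univ_mem
    (Filter.Eventually.of_forall fun y => by
      have := G.continuous.comp (continuous_coordContract i y)
      exact (Continuous.smul (weight_continuous j) this).aestronglyMeasurable)
    (by
      have := G.continuous.comp (continuous_coordContract i x)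
      exact (Continuous.smul (weight_continuous j) this).intervalIntegrable _ _)
    (by
      have h1 := hG'.comp (continuous_coordContract i x)
      have h2 := h1.clm_comp (continuous_coordContract_clm i)
      exact (Continuous.smul (weight_continuous j) h2).aestronglyMeasurable)
    (Filter.Eventually.of_forall fun t ht y _ => by
      have h1 : ‖fderiv ℝ G (coordContract i t y)‖ ≤ C :=
        norm_le_seminorm ℝ (fderivCLM ℝ (Euc n) F G) _
      have h2 : ‖coordContract i t‖ ≤ 2 := by
        have h3 := weight_le_one ht 1
        rw [pow_one] at h3
        calc ‖coordContract i t‖ ≤ ‖ContinuousLinearMap.id ℝ (Euc n)‖ + ‖(1 - t) • coordProj i‖ :=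
              norm_sub_le _ _
          _ ≤ 1 + 1 * 1 := by
              rw [norm_smul]
              exact add_le_add ContinuousLinearMap.norm_id_le
                (mul_le_mul h3 (norm_coordProj_le i) (norm_nonneg _) zero_le_one)
          _ = 2 := by norm_num
      rw [norm_smul]
      calc _ ≤ 1 * (‖fderiv ℝ G (coordContract i t y)‖ * ‖coordContract i t‖) :=
            mul_le_mul (weight_le_one ht j) (ContinuousLinearMap.opNorm_comp_le _ _)
              (norm_nonneg _) zero_le_one
        _ ≤ C * 2 := by
            rw [one_mul]
            exact mul_le_mul h1 h2 (norm_nonneg _) ((norm_nonneg _).trans h1))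
    (by simp)
    (Filter.Eventually.of_forall fun t _ y _ => by
      exact ((G.hasFDerivAt _).comp y (coordContract i t).hasFDerivAt).const_smul _)
  refine HasFDerivAt.congr_fderiv (f := segAverage i j G) key ?_
  have hc1 : Continuous fun t => (1 - t) ^ j • fderivCLM ℝ (Euc n) F G (coordContract i t x) :=
    Continuous.smul (weight_continuous j) (hG'.comp (continuous_coordContract i x))
  have hc2 : Continuous fun t => (1 - t) ^ (j + 1) • fderivProj i G (coordContract i t x) :=
    Continuous.smul (weight_continuous (j + 1))
      ((fderivProj i G).continuous.comp (continuous_coordContract i x))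
  unfold segAverage
  rw [← intervalIntegral.integral_sub (hc1.intervalIntegrable _ _) (hc2.intervalIntegrable _ _)]
  symm
  refine intervalIntegral.integral_congr fun t _ => ?_
  ext y
  simp only [fderivProj_apply, fderivCLM_apply, coordContract, sub_apply,
    smul_apply, ContinuousLinearMap.comp_apply, map_sub, map_smul, smul_sub,
    smul_smul, pow_succ, ContinuousLinearMap.id_apply]

theorem fderiv_segAverage [CompleteSpace F] (i : Fin n) (j : ℕ) (G : 𝓢(Euc n, F)) :
    fderiv ℝ (segAverage i j G) = fun x =>
      segAverage i j (fderivCLM ℝ (Euc n) F G) x - segAverage i (j + 1) (fderivProj i G) x :=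
  funext fun x => (hasFDerivAt_segAverage i j G x).fderiv

end SchwartzMap

theorem contDiff_segAverage {n : ℕ} (m : ℕ) : ∀ {F : Type} [NormedAddCommGroup F]
    [NormedSpace ℝ F] [CompleteSpace F] (i : Fin n) (j : ℕ) (G : 𝓢(Euc n, F)),
    ContDiff ℝ m (SchwartzMap.segAverage i j G) := by
  induction m with
  | zero =>
    intro F _ _ _ i j G
    refine contDiff_zero.2 (continuous_iff_continuousAt.2 fun x => ?_)
    exact (SchwartzMap.hasFDerivAt_segAverage i j G x).continuousAt
  | succ m ih =>
    intro F _ _ _ i j G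
    refine (contDiff_succ_iff_fderiv (n := (m : WithTop ℕ∞))).2
      ⟨fun x => (SchwartzMap.hasFDerivAt_segAverage i j G x).differentiableAt, by simp, ?_⟩
    rw [SchwartzMap.fderiv_segAverage]
    exact (ih i j _).sub (ih i (j + 1) _)

/-- Inside the slab the contraction moves a point by at most 1, so the decay of `G` passes to the
average. Outside it the segment may return near the origin, and this bound gives nothing. -/
theorem segAverage_decay_near {n : ℕ} (N m : ℕ) : ∀ {F : Type} [NormedAddCommGroup F]
    [NormedSpace ℝ F] [CompleteSpace F] (i : Fin n) (j : ℕ) (G : 𝓢(Euc n, F)),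
    ∃ C, ∀ x : Euc n, |x i| ≤ 1 →
      ‖x‖ ^ N * ‖iteratedFDeriv ℝ m (SchwartzMap.segAverage i j G) x‖ ≤ C := by
  induction m with
  | zero =>
    intro F _ _ _ i j G
    refine ⟨2 ^ N * (SchwartzMap.seminorm ℝ 0 0 G + SchwartzMap.seminorm ℝ N 0 G),
      fun x hx => ?_⟩
    rw [norm_iteratedFDeriv_zero]
    have hb : ∀ t ∈ Set.uIoc (0 : ℝ) 1,
        ‖‖x‖ ^ N • ((1 - t) ^ j • G (SchwartzMap.coordContract i t x))‖ ≤
        2 ^ N * (SchwartzMap.seminorm ℝ 0 0 G + SchwartzMap.seminorm ℝ N 0 G) := by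
      intro t ht
      set y := SchwartzMap.coordContract i t x with hy
      have h3 := SchwartzMap.weight_le_one ht 1
      rw [pow_one] at h3
      have hxy : ‖x‖ ≤ 1 + ‖y‖ := by
        have : x = (1 - t) • SchwartzMap.coordProj i x + y := by
          rw [hy, SchwartzMap.coordContract_apply]; abel
        calc ‖x‖ ≤ ‖(1 - t) • SchwartzMap.coordProj i x‖ + ‖y‖ := by
              conv_lhs => rw [this]
              exact norm_add_le _ _
          _ ≤ 1 * 1 + ‖y‖ := by
              rw [norm_smul, SchwartzMap.norm_coordProj_apply]
              gcongr
          _ = 1 + ‖y‖ := by ring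
      have hp : ‖x‖ ^ N ≤ 2 ^ N * (1 + ‖y‖ ^ N) := by
        rcases le_total ‖y‖ 1 with h | h
        · calc ‖x‖ ^ N ≤ 2 ^ N := by gcongr; linarith
            _ ≤ 2 ^ N * (1 + ‖y‖ ^ N) := by
              have : (0 : ℝ) ≤ ‖y‖ ^ N := by positivity
              nlinarith [pow_pos (two_pos : (0 : ℝ) < 2) N]
        · calc ‖x‖ ^ N ≤ (2 * ‖y‖) ^ N := by gcongr; linarith
            _ = 2 ^ N * ‖y‖ ^ N := mul_pow _ _ _
            _ ≤ 2 ^ N * (1 + ‖y‖ ^ N) := by gcongr; linarith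
      rw [norm_smul, norm_smul, norm_pow, norm_norm]
      calc ‖x‖ ^ N * (‖(1 - t) ^ j‖ * ‖G y‖) ≤ 2 ^ N * (1 + ‖y‖ ^ N) * (1 * ‖G y‖) := by
            gcongr
            exact SchwartzMap.weight_le_one ht j
        _ = 2 ^ N * (‖G y‖ + ‖y‖ ^ N * ‖G y‖) := by ring
        _ ≤ _ := by
            gcongr
            · exact SchwartzMap.norm_le_seminorm ℝ G y
            · exact SchwartzMap.norm_pow_mul_le_seminorm ℝ G N y
    have := intervalIntegral.norm_integral_le_of_norm_le_const hb
    rw [intervalIntegral.integral_smul, norm_smul, norm_pow, norm_norm] at this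
    simpa [SchwartzMap.segAverage] using this
  | succ m ih =>
    intro F _ _ _ i j G
    obtain ⟨C₁, h₁⟩ := ih i j (SchwartzMap.fderivCLM ℝ (Euc n) F G)
    obtain ⟨C₂, h₂⟩ := ih i (j + 1) (SchwartzMap.fderivProj i G)
    refine ⟨C₁ + C₂, fun x hx => ?_⟩
    rw [← norm_iteratedFDeriv_fderiv, SchwartzMap.fderiv_segAverage]
    have := iteratedFDeriv_sub_apply (x := x)
      (contDiff_segAverage m i j (SchwartzMap.fderivCLM ℝ (Euc n) F G)).contDiffAt
      (contDiff_segAverage m i (j + 1) (SchwartzMap.fderivProj i G)).contDiffAt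
    calc _ = ‖x‖ ^ N * ‖iteratedFDeriv ℝ m
            (SchwartzMap.segAverage i j (SchwartzMap.fderivCLM ℝ (Euc n) F G)) x -
            iteratedFDeriv ℝ m
              (SchwartzMap.segAverage i (j + 1) (SchwartzMap.fderivProj i G)) x‖ := by
            rw [← this]; rfl
      _ ≤ _ := (mul_le_mul_of_nonneg_left (norm_sub_le _ _) (by positivity)).trans
            (by rw [mul_add]; exact add_le_add (h₁ x hx) (h₂ x hx))

/-- Away from the hyperplane `xᵢ = 0`, division by `xᵢ` preserves rapid decay. -/
theorem decay_far_of_coord_smul {n : ℕ} (i : Fin n) (m : ℕ) : ∀ {F : Type}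
    [NormedAddCommGroup F] [NormedSpace ℝ F] (g h : Euc n → F), ContDiff ℝ (⊤ : ℕ∞) g →
    ContDiff ℝ (⊤ : ℕ∞) h → (∀ x, g x = x i • h x) →
    (∀ N, ∀ p ≤ m, ∃ C, ∀ x : Euc n, 1 ≤ |x i| → ‖x‖ ^ N * ‖iteratedFDeriv ℝ p g x‖ ≤ C) →
    ∀ N, ∀ p ≤ m, ∃ C, ∀ x : Euc n, 1 ≤ |x i| → ‖x‖ ^ N * ‖iteratedFDeriv ℝ p h x‖ ≤ C := by
  have base : ∀ {F : Type} [NormedAddCommGroup F] [NormedSpace ℝ F] (g h : Euc n → F),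
      (∀ x, g x = x i • h x) → ∀ N,
      (∃ C, ∀ x : Euc n, 1 ≤ |x i| → ‖x‖ ^ N * ‖iteratedFDeriv ℝ 0 g x‖ ≤ C) →
      ∃ C, ∀ x : Euc n, 1 ≤ |x i| → ‖x‖ ^ N * ‖iteratedFDeriv ℝ 0 h x‖ ≤ C := by
    rintro F _ _ g h hgh N ⟨C, hC⟩
    refine ⟨C, fun x hx => le_trans ?_ (hC x hx)⟩
    rw [norm_iteratedFDeriv_zero, norm_iteratedFDeriv_zero, hgh, norm_smul, Real.norm_eq_abs]
    gcongr
    exact le_mul_of_one_le_left (norm_nonneg _) hx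
  induction m with
  | zero =>
    intro F _ _ g h _ _ hgh hg N p hp
    obtain rfl : p = 0 := by omega
    exact base g h hgh N (hg N 0 le_rfl)
  | succ m ih =>
    intro F _ _ g h hgs hhs hgh hg N p hp
    have hIH := ih g h hgs hhs hgh fun N p hp => hg N p (by omega)
    rcases p with _ | p
    · exact base g h hgh N (hg N 0 (by omega))
    have hdg : ContDiff ℝ (⊤ : ℕ∞) (fderiv ℝ g) := hgs.fderiv_right (by simp)
    have hdh : ContDiff ℝ (⊤ : ℕ∞) (fderiv ℝ h) := hhs.fderiv_right (by simp)
    set L : F →L[ℝ] (Euc n →L[ℝ] F) :=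
      ContinuousLinearMap.smulRightL ℝ (Euc n) F (EuclideanSpace.proj i) with hL
    have hLh : ContDiff ℝ (⊤ : ℕ∞) fun x => L (h x) := L.contDiff.comp hhs
    -- The product rule puts `fderiv ℝ h` in the same situation as `h`, with one order less to
    -- control.
    have hrel : ∀ x, (fderiv ℝ g x - L (h x)) = x i • fderiv ℝ h x := by
      intro x
      have e : g = (fun x : Euc n => x i) • h := funext hgh
      have h1 : HasFDerivAt (fun x : Euc n => x i)
          (EuclideanSpace.proj i : Euc n →L[ℝ] ℝ) x :=
        (EuclideanSpace.proj i : Euc n →L[ℝ] ℝ).hasFDerivAt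
      have h2 := (hhs.differentiable (by simp) x).hasFDerivAt
      rw [e, (h1.smul h2).fderiv]
      ext y
      simp [hL]
    have hp' : p ≤ m := by omega
    obtain ⟨C, hC⟩ := ih (fun x => fderiv ℝ g x - L (h x)) (fderiv ℝ h) (hdg.sub hLh) hdh hrel
      (fun N p hp => by
        obtain ⟨C₁, h₁⟩ := hg N (p + 1) (by omega)
        obtain ⟨C₂, h₂⟩ := hIH N p hp
        refine ⟨C₁ + ‖L‖ * C₂, fun x hx => ?_⟩
        have hle : (p : WithTop ℕ∞) ≤ ((⊤ : ℕ∞) : WithTop ℕ∞) := by exact_mod_cast le_top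
        have e := iteratedFDeriv_sub_apply (x := x) (hdg.of_le hle).contDiffAt
          (hLh.of_le hle).contDiffAt
        have e2 : ‖iteratedFDeriv ℝ p (fun x => L (h x)) x‖ ≤ ‖L‖ * ‖iteratedFDeriv ℝ p h x‖ :=
          L.norm_iteratedFDeriv_comp_left hhs.contDiffAt hle
        have h₁' := h₁ x hx
        rw [← norm_iteratedFDeriv_fderiv] at h₁'
        calc _ = ‖x‖ ^ N * ‖iteratedFDeriv ℝ p (fderiv ℝ g) x -
                iteratedFDeriv ℝ p (fun x => L (h x)) x‖ := by rw [← e]; rfl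
          _ ≤ ‖x‖ ^ N * (‖iteratedFDeriv ℝ p (fderiv ℝ g) x‖ +
                ‖L‖ * ‖iteratedFDeriv ℝ p h x‖) := by
              gcongr
              exact (norm_sub_le _ _).trans (by gcongr)
          _ = ‖x‖ ^ N * ‖iteratedFDeriv ℝ p (fderiv ℝ g) x‖ +
                ‖L‖ * (‖x‖ ^ N * ‖iteratedFDeriv ℝ p h x‖) := by ring
          _ ≤ _ := by
              gcongr
              exact h₂ x hx) N p hp'
    refine ⟨C, fun x hx => ?_⟩
    rw [← norm_iteratedFDeriv_fderiv]
    exact hC x hx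

/-- Hadamard division: a Schwartz function vanishing on `xᵢ = 0` is `xᵢ` times a Schwartz
function. -/
theorem SchwartzMap.exists_eq_coord_smul {n : ℕ} {F : Type} [NormedAddCommGroup F]
    [NormedSpace ℝ F] [CompleteSpace F] (i : Fin n) (g : 𝓢(Euc n, F))
    (hg : ∀ x : Euc n, x i = 0 → g x = 0) : ∃ h : 𝓢(Euc n, F), ∀ x, g x = x i • h x := by
  set G : 𝓢(Euc n, F) := (fderivCLM ℝ (Euc n) F g).postcompCLM
    (ContinuousLinearMap.apply ℝ F (EuclideanSpace.single i (1 : ℝ))) with hG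
  have hsm : ContDiff ℝ (⊤ : ℕ∞) (segAverage i 0 G) :=
    contDiff_infty.2 fun m => contDiff_segAverage m i 0 G
  -- Fundamental theorem of calculus on the segment from the hyperplane to `x`, where `G` is the
  -- `i`-th partial derivative of `g`.
  have hrel : ∀ x, g x = x i • segAverage i 0 G x := by
    intro x
    have hd : ∀ t ∈ Set.uIcc (0 : ℝ) 1,
        HasDerivAt (fun t => g (coordContract i t x)) (x i • G (coordContract i t x)) t := by
      intro t _
      have h1 : HasDerivAt (fun t => coordContract i t x) (coordProj i x) t := by
        simp only [coordContract_apply]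
        have := (((hasDerivAt_id t).const_sub 1).smul_const (coordProj i x)).const_sub x
        simpa using this
      have h2 := (g.hasFDerivAt (coordContract i t x)).comp_hasDerivAt t h1
      rw [coordProj_apply, map_smul] at h2
      exact h2
    have hc : Continuous fun t => x i • G (coordContract i t x) :=
      (G.continuous.comp (continuous_coordContract i x)).const_smul _
    have := intervalIntegral.integral_eq_sub_of_hasDerivAt hd (hc.intervalIntegrable _ _)
    have h0 : g (coordContract i 0 x) = 0 := by
      apply hg
      simp [coordContract_apply, coordProj_apply]
    have h1 : coordContract i 1 x = x := by simp [coordContract_apply]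
    rw [h0, h1, sub_zero, intervalIntegral.integral_smul] at this
    simpa [segAverage] using this.symm
  refine ⟨⟨segAverage i 0 G, hsm, fun N m => ?_⟩, hrel⟩
  obtain ⟨C₁, h₁⟩ := segAverage_decay_near N m i 0 G
  obtain ⟨C₂, h₂⟩ := decay_far_of_coord_smul i m g (segAverage i 0 G) (g.smooth _) hsm hrel
    (fun N p _ => (g.decay N p).imp fun C hC x _ => hC.2 x) N m le_rfl
  refine ⟨max C₁ C₂, fun x => ?_⟩
  rcases le_total |x i| 1 with h | h
  · exact (h₁ x h).trans (le_max_left _ _)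
  · exact (h₂ x h).trans (le_max_right _ _)

/-! ### Fourier slice argument -/

theorem measurePreserving_shear {n : ℕ} (ξ : Euc n) :
    MeasurePreserving (fun p : ℝ × Euc n => (p.1, p.2 + p.1 • ξ))
      ((volume : Measure ℝ).prod volume) ((volume : Measure ℝ).prod volume) := by
  refine (MeasurePreserving.id (volume : Measure ℝ)).skew_product
    (g := fun t x => x + t • ξ) ?_ (Filter.Eventually.of_forall fun t => ?_)
  · exact (continuous_snd.add (continuous_fst.smul continuous_const)).measurable
  · exact (measurePreserving_add_right volume (t • ξ)).map_eq

theorem integrable_gaussian_shift (c : ℝ) :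
    Integrable fun t : ℝ => ((Real.exp (-(c - t) ^ 2) : ℝ) : ℂ) := by
  have h := (integrable_exp_neg_mul_sq (b := 1) one_pos).comp_sub_left c
  simpa using h.ofReal (𝕜 := ℂ)

theorem integral_gaussian_shift (c : ℝ) :
    ∫ t : ℝ, ((Real.exp (-(c - t) ^ 2) : ℝ) : ℂ) = (Real.sqrt Real.pi : ℂ) := by
  have h := integral_sub_left_eq_self (fun t : ℝ => Real.exp (-1 * t ^ 2)) volume c
  rw [integral_gaussian] at h
  rw [integral_complex_ofReal]
  simpa using congrArg (fun r : ℝ => (r : ℂ)) h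

/-- A Schwartz function whose integrals over all lines parallel to `ξ` vanish has a Fourier
transform vanishing on the hyperplane orthogonal to `ξ`. -/
theorem fourier_eq_zero_of_line_integrals {n : ℕ} (g : 𝓢(Euc n, ℂ)) (ξ k : Euc n)
    (hξ : ‖ξ‖ = 1) (hk : inner ℝ ξ k = 0) (hg : ∀ x, ∫ t : ℝ, g (x + t • ξ) = 0) :
    𝓕 g k = 0 := by
  have hcf : Continuous fun x : Euc n => ((Real.fourierChar (-(inner ℝ x k)) : Circle) : ℂ) :=
    continuous_subtype_val.comp (Real.continuous_fourierChar.comp (by fun_prop))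
  set e : Euc n → ℂ := fun x => (Real.fourierChar (-(inner ℝ x k)) : Circle) with he
  have hne : ∀ x, ‖e x‖ = 1 := fun x => Circle.norm_coe _
  have hF : 𝓕 g k = ∫ x, e x * g x := by
    rw [SchwartzMap.fourier_coe, Real.fourier_eq]
    rfl
  -- The auxiliary variable with a Gaussian weight of mass √π replaces the splitting of the space
  -- into ℝξ and its complement: integrating it out first recovers √π times the transform, while
  -- shearing first isolates the line integrals.
  set H : ℝ × Euc n → ℂ := fun p =>
    ((Real.exp (-(inner ℝ p.2 ξ - p.1) ^ 2) : ℝ) : ℂ) * (e p.2 * g p.2) with hH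
  have hHc : Continuous H := by
    have h1 : Continuous fun p : ℝ × Euc n => e p.2 * g p.2 :=
      (hcf.mul g.continuous).comp continuous_snd
    have h2 : Continuous fun p : ℝ × Euc n =>
        ((Real.exp (-(inner ℝ p.2 ξ - p.1) ^ 2) : ℝ) : ℂ) :=
      Complex.continuous_ofReal.comp (by fun_prop)
    exact h2.mul h1
  have hHi : Integrable H ((volume : Measure ℝ).prod volume) := by
    have hm : AEStronglyMeasurable H ((volume : Measure ℝ).prod (volume : Measure (Euc n))) :=
      hHc.aestronglyMeasurable
    refine (integrable_prod_iff' hm).2 ⟨?_, ?_⟩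
    · exact Filter.Eventually.of_forall fun x =>
        (integrable_gaussian_shift (inner ℝ x ξ)).mul_const (e x * g x)
    · have : ∀ x : Euc n, ∫ t, ‖H (t, x)‖ = Real.sqrt Real.pi * ‖g x‖ := by
        intro x
        simp only [hH, norm_mul, hne, one_mul, Complex.norm_real, Real.norm_eq_abs,
          Real.abs_exp]
        rw [integral_mul_const]
        congr 1
        have := integral_gaussian_shift (inner ℝ x ξ)
        rw [integral_complex_ofReal] at this
        exact_mod_cast this
      simp only [this]
      exact g.integrable.norm.const_mul _
  have h1 : ∫ p, H p ∂((volume : Measure ℝ).prod volume) = Real.sqrt Real.pi * 𝓕 g k := by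
    rw [integral_prod_symm _ hHi, hF, ← integral_const_mul]
    refine integral_congr_ae (Filter.Eventually.of_forall fun x => ?_)
    simp only [hH]
    rw [integral_mul_const, integral_gaussian_shift]
  have hmp := measurePreserving_shear ξ
  have hKi : Integrable (fun p : ℝ × Euc n => H (p.1, p.2 + p.1 • ξ))
      ((volume : Measure ℝ).prod volume) := hmp.integrable_comp_of_integrable hHi
  have h2 : ∫ p, H p ∂((volume : Measure ℝ).prod volume) = 0 := by
    have : ∫ p, H p ∂((volume : Measure ℝ).prod volume) =
        ∫ p : ℝ × Euc n, H (p.1, p.2 + p.1 • ξ) ∂((volume : Measure ℝ).prod volume) := by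
      conv_lhs => rw [← hmp.map_eq]
      exact integral_map hmp.measurable.aemeasurable hHc.aestronglyMeasurable
    rw [this, integral_prod_symm _ hKi]
    have hz : ∀ x : Euc n, ∫ t : ℝ, H (t, x + t • ξ) = 0 := by
      intro x
      -- After the shear neither the Gaussian (as |ξ| = 1) nor the character (as ξ ⊥ k) depends on
      -- `t`.
      have hpt : ∀ t : ℝ, H (t, x + t • ξ) =
          ((Real.exp (-(inner ℝ x ξ) ^ 2) : ℝ) : ℂ) * e x * g (x + t • ξ) := by
        intro t
        have a1 : inner ℝ (x + t • ξ) ξ - t = inner ℝ x ξ := by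
          rw [inner_add_left, inner_smul_left, real_inner_self_eq_norm_sq, hξ]; simp
        have a2 : e (x + t • ξ) = e x := by
          simp only [he]
          rw [inner_add_left, inner_smul_left, hk]; simp
        simp only [hH]
        rw [a1, a2]; ring
      simp only [hpt]
      rw [integral_const_mul, hg, mul_zero]
    simp only [hz, integral_zero]
  rw [h1] at h2
  refine (mul_eq_zero.1 h2).resolve_left ?_
  exact_mod_cast (Real.sqrt_pos.2 Real.pi_pos).ne'

/-! ### Solving the symbol equations by division -/

/-- Multiplication of a Schwartz function by the `i`-th coordinate. -/
def coordMul {n : ℕ} (i : Fin n) : 𝓢(Euc n, ℂ) →L[ℂ] 𝓢(Euc n, ℂ) :=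
  SchwartzMap.smulLeftCLM ℂ fun x : Euc n => ((x i : ℝ) : ℂ)

theorem coord_hasTemperateGrowth {n : ℕ} (i : Fin n) :
    (fun x : Euc n => ((x i : ℝ) : ℂ)).HasTemperateGrowth :=
  (Complex.ofRealCLM.comp (EuclideanSpace.proj i : Euc n →L[ℝ] ℝ)).hasTemperateGrowth

@[simp]
theorem coordMul_apply {n : ℕ} (i : Fin n) (g : 𝓢(Euc n, ℂ)) (x : Euc n) :
    coordMul i g x = (x i : ℂ) * g x :=
  SchwartzMap.smulLeftCLM_apply_apply (coord_hasTemperateGrowth i) g x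

/-- A factor `xᵢ` may be cancelled from an identity between continuous functions. -/
theorem eq_zero_of_coord_mul_eq_zero {n : ℕ} (i : Fin n) {c : Euc n → ℂ} (hc : Continuous c)
    (h : ∀ x : Euc n, (x i : ℂ) * c x = 0) (x : Euc n) : c x = 0 := by
  have hc' : Continuous fun t : ℝ => c (x + t • EuclideanSpace.single i (1 : ℝ)) :=
    hc.comp (by fun_prop)
  have hd : Dense ({-x i}ᶜ : Set ℝ) := dense_compl_singleton _
  have := Continuous.ext_on hd hc' continuous_const (g := fun _ => 0) fun t ht => by
    have h1 := h (x + t • EuclideanSpace.single i (1 : ℝ))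
    refine (mul_eq_zero.1 h1).resolve_left fun h2 => ht ?_
    have h3 : x i + t = 0 := by
      have : ((x i + t : ℝ) : ℂ) = 0 := by simpa using h2
      exact_mod_cast this
    simp only [Set.mem_singleton_iff]; linarith
  simpa using congrFun this 0

/-- In the plane, a power of `xᵢ` may be cancelled on the line `xⱼ = 0`. -/
theorem eq_zero_of_coord_pow_mul_eq_zero_on_axis {i j : Fin 2} (hij : i ≠ j) {c : Euc 2 → ℂ}
    (hc : Continuous c) (m : ℕ) (h : ∀ x : Euc 2, x j = 0 → (x i : ℂ) ^ m * c x = 0)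
    (x : Euc 2) (hx : x j = 0) : c x = 0 := by
  have hc' : Continuous fun t : ℝ => c (x + t • EuclideanSpace.single i (1 : ℝ)) :=
    hc.comp (by fun_prop)
  have hd : Dense ({-x i}ᶜ : Set ℝ) := dense_compl_singleton _
  have := Continuous.ext_on hd hc' continuous_const (g := fun _ => 0) fun t ht => by
    have h1 := h (x + t • EuclideanSpace.single i (1 : ℝ)) (by simp [hx, hij.symm])
    refine (mul_eq_zero.1 h1).resolve_left fun h2 => ht ?_
    have h3 : x i + t = 0 := by
      have h4 := eq_zero_of_pow_eq_zero h2
      have : ((x i + t : ℝ) : ℂ) = 0 := by simpa using h4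
      exact_mod_cast this
    simp only [Set.mem_singleton_iff]; linarith
  simpa using congrFun this 0

theorem exists_eq_coord_mul {n : ℕ} (i : Fin n) (g : 𝓢(Euc n, ℂ))
    (hg : ∀ x : Euc n, x i = 0 → g x = 0) : ∃ h : 𝓢(Euc n, ℂ), ∀ x, g x = (x i : ℂ) * h x := by
  obtain ⟨h, hh⟩ := g.exists_eq_coord_smul i hg
  exact ⟨h, fun x => by rw [hh, Complex.real_smul]⟩

/-- In the plane, a Schwartz function is divisible by `xⱼ` if its product with a power of the
other coordinate vanishes on `xⱼ = 0`. -/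
theorem exists_eq_coord_mul_of_pow_mul {i j : Fin 2} (hij : i ≠ j) (g : 𝓢(Euc 2, ℂ)) (m : ℕ)
    (h : ∀ x : Euc 2, x j = 0 → (x i : ℂ) ^ m * g x = 0) :
    ∃ h : 𝓢(Euc 2, ℂ), ∀ x, g x = (x j : ℂ) * h x :=
  exists_eq_coord_mul j g (eq_zero_of_coord_pow_mul_eq_zero_on_axis hij g.continuous m h)

/-- Solution of the algebraic system satisfied by the Fourier transform of a planar elastic
2-tensor field in the kernel of the elastic ray transform. -/
theorem exists_potentials_of_symbol_eq
    (a b c d p q : 𝓢(Euc 2, ℂ))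
    (h₁ : ∀ k : Euc 2, a k * (k 1 : ℂ) ^ 4 - 4 * b k * (k 0 : ℂ) * (k 1 : ℂ) ^ 3 +
      (2 * c k + 4 * d k) * (k 0 : ℂ) ^ 2 * (k 1 : ℂ) ^ 2 - 4 * p k * (k 0 : ℂ) ^ 3 * (k 1 : ℂ) +
      q k * (k 0 : ℂ) ^ 4 = 0)
    (h₂ : ∀ k : Euc 2, (k 0 : ℂ) ^ 2 * (k 1 : ℂ) ^ 2 * (a k + q k - 2 * c k) -
      2 * (k 0 : ℂ) * (k 1 : ℂ) * ((k 0 : ℂ) ^ 2 - (k 1 : ℂ) ^ 2) * (b k - p k) +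
      ((k 0 : ℂ) ^ 2 - (k 1 : ℂ) ^ 2) ^ 2 * d k = 0) :
    ∃ U₀ U₁ T V : 𝓢(Euc 2, ℂ), ∀ k : Euc 2,
      a k = k 0 * U₀ k ∧
      b k = 1 / 2 * (k 0 : ℂ) ^ 2 * T k + 1 / 4 * (k 0 * U₁ k + k 1 * U₀ k) ∧
      c k = 1 / 2 * (k 0 : ℂ) ^ 2 * V k + 1 / 2 * (k 0 * U₀ k + k 1 * U₁ k) ∧
      d k = k 0 * k 1 * T k ∧
      p k = 1 / 2 * (k 0 * k 1 * V k + (k 1 : ℂ) ^ 2 * T k) +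
        1 / 4 * (k 0 * U₁ k + k 1 * U₀ k) ∧
      q k = (k 1 : ℂ) ^ 2 * V k + k 1 * U₁ k := by
  have e10 : (1 : Fin 2) ≠ 0 := by decide
  have e01 : (0 : Fin 2) ≠ 1 := by decide
  have cx : ∀ i : Fin 2, Continuous fun k : Euc 2 => (k i : ℂ) := fun i =>
    (coord_hasTemperateGrowth i).1.continuous
  have cS : ∀ f : 𝓢(Euc 2, ℂ), Continuous fun k => f k := fun f => f.continuous
  -- On k₀ = 0 the second equation reduces to k₁⁴ d = 0.
  obtain ⟨d₁, hd₁⟩ := exists_eq_coord_mul_of_pow_mul e10 d 4 fun k hk => by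
    have := h₂ k
    rw [hk, Complex.ofReal_zero] at this
    linear_combination this
  -- On k₁ = 0 it reduces to k₀⁴ d = k₀⁵ d₁ = 0, hence the exponent 5.
  obtain ⟨T, hT⟩ := exists_eq_coord_mul 1 d₁ fun k hk =>
    eq_zero_of_coord_pow_mul_eq_zero_on_axis e01 d₁.continuous 5 (fun k hk => by
      have := h₂ k
      rw [hk, hd₁, Complex.ofReal_zero] at this
      linear_combination this) k hk
  obtain ⟨U₀, hU₀⟩ := exists_eq_coord_mul_of_pow_mul e10 a 4 fun k hk => by
    have := h₁ k
    rw [hk, Complex.ofReal_zero] at this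
    linear_combination this
  have r₁ : ∀ k : Euc 2, U₀ k * (k 1 : ℂ) ^ 4 - 4 * b k * (k 1 : ℂ) ^ 3 +
      (2 * c k + 4 * d k) * k 0 * (k 1 : ℂ) ^ 2 - 4 * p k * (k 0 : ℂ) ^ 2 * k 1 +
      q k * (k 0 : ℂ) ^ 3 = 0 :=
    eq_zero_of_coord_mul_eq_zero 0 (by fun_prop) fun k => by
      linear_combination h₁ k - (k 1 : ℂ) ^ 4 * hU₀ k
  obtain ⟨A, hA⟩ := exists_eq_coord_mul_of_pow_mul e10 ((4 : ℂ) • b - coordMul 1 U₀) 3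
    fun k hk => by
      have := r₁ k
      rw [hk, Complex.ofReal_zero] at this
      simp only [sub_apply, smul_apply, coordMul_apply, smul_eq_mul]
      linear_combination -this
  simp only [sub_apply, smul_apply, coordMul_apply, smul_eq_mul] at hA
  -- The shift by 2k₀T is dictated by the required form of `b`, which contains ½k₀²T.
  set U₁ : 𝓢(Euc 2, ℂ) := A - (2 : ℂ) • coordMul 0 T with hU₁
  have hU₁' : ∀ k, U₁ k = A k - 2 * (k 0 * T k) := fun k => by simp [hU₁]
  have r₂ : ∀ k : Euc 2, 2 * k 0 * (k 1 : ℂ) ^ 3 * T k - (k 1 : ℂ) ^ 3 * U₁ k +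
      2 * c k * (k 1 : ℂ) ^ 2 - 4 * p k * k 0 * k 1 + q k * (k 0 : ℂ) ^ 2 = 0 :=
    eq_zero_of_coord_mul_eq_zero 0 (by fun_prop) fun k => by
      have h := r₁ k
      rw [hd₁, hT] at h
      rw [hU₁']
      linear_combination h + (k 1 : ℂ) ^ 3 * hA k
  obtain ⟨B, hB⟩ := exists_eq_coord_mul_of_pow_mul e10 ((2 : ℂ) • c - coordMul 1 U₁) 2
    fun k hk => by
      have := r₂ k
      rw [hk, Complex.ofReal_zero] at this
      simp only [sub_apply, smul_apply, coordMul_apply, smul_eq_mul]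
      linear_combination this
  simp only [sub_apply, smul_apply, coordMul_apply, smul_eq_mul] at hB
  have r₃ : ∀ k : Euc 2, 2 * (k 1 : ℂ) ^ 3 * T k + (k 1 : ℂ) ^ 2 * B k - 4 * p k * k 1 +
      q k * k 0 = 0 :=
    eq_zero_of_coord_mul_eq_zero 0 (by fun_prop) fun k => by
      linear_combination r₂ k - (k 1 : ℂ) ^ 2 * hB k
  obtain ⟨D, hD⟩ := exists_eq_coord_mul_of_pow_mul e01 q 1 fun k hk => by
    have := r₃ k
    rw [hk, Complex.ofReal_zero] at this
    linear_combination this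
  have r₄ : ∀ k : Euc 2, 2 * (k 1 : ℂ) ^ 2 * T k + k 1 * B k - 4 * p k + k 0 * D k = 0 :=
    eq_zero_of_coord_mul_eq_zero 1 (by fun_prop) fun k => by
      linear_combination r₃ k - (k 0 : ℂ) * hD k
  -- The first equation is now exhausted. Substituted into the second, the quotients leave ½k₀k₁
  -- times this expression.
  have r₅ : ∀ k : Euc 2, ((k 0 : ℂ) ^ 2 + (k 1 : ℂ) ^ 2) *
      (k 0 * (D k - U₁ k) - k 1 * (B k - U₀ k)) = 0 :=
    eq_zero_of_coord_mul_eq_zero 0 (by fun_prop) <|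
      eq_zero_of_coord_mul_eq_zero 1 (by fun_prop) fun k => by
        have h := h₂ k
        have h' := r₄ k
        have h'' := hA k
        have hU := hU₁' k
        rw [hd₁, hT, hU₀, hD] at h
        have hb : b k = (k 1 * U₀ k + k 0 * (U₁ k + 2 * (k 0 * T k))) / 4 := by
          rw [hU]; linear_combination h'' / 4
        have hc : c k = (k 1 * U₁ k + k 0 * B k) / 2 := by linear_combination hB k / 2
        have hp : p k = (2 * (k 1 : ℂ) ^ 2 * T k + k 1 * B k + k 0 * D k) / 4 := by
          linear_combination -h' / 4
        rw [hb, hc, hp] at h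
        linear_combination 2 * h
  have r₆ : ∀ k : Euc 2, k 0 * (D k - U₁ k) - k 1 * (B k - U₀ k) = 0 :=
    eq_zero_of_coord_mul_eq_zero 0 (by fun_prop) fun k => by
      rcases mul_eq_zero.1 (r₅ k) with h | h
      · have h' : (k 0 : ℝ) ^ 2 + (k 1 : ℝ) ^ 2 = (0 : ℝ) := by
          rw [← Complex.ofReal_inj]; push_cast; exact h
        have : k 0 = 0 := by nlinarith [sq_nonneg (k 0), sq_nonneg (k 1)]
        rw [this]; simp
      · rw [h, mul_zero]
  -- By `r₆`, k₀(D - U₁) = k₁(B - U₀), so a single `V` serves for both differences.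
  obtain ⟨V, hV⟩ := exists_eq_coord_mul_of_pow_mul e10 (B - U₀) 1 fun k hk => by
    have := r₆ k
    rw [hk, Complex.ofReal_zero] at this
    simp only [sub_apply]
    linear_combination -this
  simp only [sub_apply] at hV
  have hDV : ∀ k : Euc 2, D k - U₁ k - k 1 * V k = 0 :=
    eq_zero_of_coord_mul_eq_zero 0 (by fun_prop) fun k => by
      linear_combination r₆ k + (k 1 : ℂ) * hV k
  refine ⟨U₀, U₁, T, V, fun k => ⟨hU₀ k, ?_, ?_, ?_, ?_, ?_⟩⟩
  · have := hU₁' k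
    linear_combination hA k / 4 - k 0 / 4 * this
  · linear_combination hB k / 2 + k 0 / 2 * hV k
  · rw [hd₁, hT]; ring
  · linear_combination -r₄ k / 4 + k 1 / 4 * hV k + k 0 / 4 * hDV k
  · linear_combination hD k + k 1 * hDV k

/-! ### Potentials lie in the kernel -/

theorem SchwartzMap.vanishesAtInfinity {n : ℕ} (N : ℕ∞) (g : 𝓢(Euc n, ℝ)) :
    VanishesAtInfinity N g := by
  intro m _
  obtain ⟨C, _, hC⟩ := g.decay 1 m
  have h0 : Tendsto (fun x : Euc n => C * ‖x‖⁻¹) (cocompact (Euc n)) (𝓝 0) := by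
    simpa using (tendsto_inv_atTop_zero.comp (tendsto_norm_cocompact_atTop (E := Euc n))).const_mul C
  refine squeeze_zero' (Eventually.of_forall fun x => norm_nonneg _) ?_ h0
  filter_upwards [(tendsto_norm_cocompact_atTop (E := Euc n)).eventually_gt_atTop 0] with x hx
  rw [← div_eq_mul_inv, le_div_iff₀ hx, mul_comm]
  simpa using hC x

theorem hasDerivAt_along_line {n : ℕ} {g : Euc n → ℝ} (hg : Differentiable ℝ g) (x ξ : Euc n)
    (t : ℝ) : HasDerivAt (fun t => g (x + t • ξ)) (∑ i, ξ i * partialD i g (x + t • ξ)) t := by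
  have h1 : HasDerivAt (fun t : ℝ => x + t • ξ) ξ t := by
    simpa using ((hasDerivAt_id t).smul_const ξ).const_add x
  have h2 := (hg (x + t • ξ)).hasFDerivAt.comp_hasDerivAt t h1
  have h3 : ξ = ∑ i, ξ i • EuclideanSpace.single i (1 : ℝ) := by
    simpa using ((EuclideanSpace.basisFun (Fin n) ℝ).sum_repr ξ).symm
  have h4 : fderiv ℝ g (x + t • ξ) ξ = ∑ i, ξ i * partialD i g (x + t • ξ) := by
    refine (congrArg (fderiv ℝ g (x + t • ξ)) h3).trans ?_
    rw [map_sum]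
    exact Finset.sum_congr rfl fun i _ => map_smul _ _ _
  rw [← h4]
  exact h2

theorem isometry_line {n : ℕ} (x : Euc n) {ξ : Euc n} (hξ : ‖ξ‖ = 1) :
    Isometry fun t : ℝ => x + t • ξ := by
  refine Isometry.of_dist_eq fun s t => ?_
  rw [dist_add_left, dist_eq_norm, ← sub_smul, norm_smul, hξ, mul_one, Real.dist_eq,
    Real.norm_eq_abs]

theorem tendsto_line_cocompact {n : ℕ} (x : Euc n) {ξ : Euc n} (hξ : ‖ξ‖ = 1) :
    Tendsto (fun t : ℝ => x + t • ξ) (cocompact ℝ) (cocompact (Euc n)) :=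
  (isometry_line x hξ).isClosedEmbedding.tendsto_cocompact

theorem SchwartzMap.integrable_along_line {n : ℕ} (g : 𝓢(Euc n, ℝ)) (x : Euc n) {ξ : Euc n}
    (hξ : ‖ξ‖ = 1) : Integrable fun t : ℝ => g (x + t • ξ) := by
  have hg : (fun t : ℝ => x + t • ξ).HasTemperateGrowth :=
    (Function.HasTemperateGrowth.const x).add
      ((ContinuousLinearMap.id ℝ ℝ).smulRight ξ).hasTemperateGrowth
  exact (SchwartzMap.compCLMOfAntilipschitz ℝ hg (isometry_line x hξ).antilipschitz g).integrable

theorem differentiable_partialD {n : ℕ} {g : Euc n → ℝ} (hg : ContDiff ℝ (⊤ : ℕ∞) g)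
    (i : Fin n) : Differentiable ℝ (partialD i g) := by
  have h : ContDiff ℝ (⊤ : ℕ∞) (fderiv ℝ g) := hg.fderiv_right (by simp)
  exact (h.differentiable (by simp)).clm_apply (differentiable_const _)

theorem VanishesAtInfinity.tendsto_zero {n : ℕ} {N : ℕ∞} {g : Euc n → ℝ}
    (hg : VanishesAtInfinity N g) : Tendsto g (cocompact (Euc n)) (𝓝 0) := by
  have := hg 0 (by simp)
  simp only [norm_iteratedFDeriv_zero] at this
  exact tendsto_zero_iff_norm_tendsto_zero.2 this

theorem VanishesAtInfinity.tendsto_partialD_zero {n : ℕ} {N : ℕ∞} (hN : 1 ≤ N) {g : Euc n → ℝ}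
    (hg : VanishesAtInfinity N g) (i : Fin n) :
    Tendsto (partialD i g) (cocompact (Euc n)) (𝓝 0) := by
  have := hg 1 (by simpa using hN)
  simp only [norm_iteratedFDeriv_one] at this
  refine squeeze_zero_norm (fun x => ?_) this
  simpa [partialD] using (fderiv ℝ g x).le_opNorm (EuclideanSpace.single i 1)

/-- Orthogonality kills the first factor and parallelism the second. -/
theorem polarizationPairs_mul_eq_zero {ξ ζ : Euc 2}
    (h : (ξ, ζ) ∈ polarizationPairs 2) :
    (ξ 0 * ζ 0 + ξ 1 * ζ 1) * (ξ 0 * ζ 1 - ξ 1 * ζ 0) = 0 := by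
  rcases h.2 with h | h
  · obtain ⟨c, hc⟩ := Submodule.mem_span_singleton.1 h
    simp only at hc
    rw [← hc]
    simp only [PiLp.smul_apply, smul_eq_mul]
    ring
  · have := Submodule.mem_orthogonal_singleton_iff_inner_right.1 h
    simp only [PiLp.inner_apply, Fin.sum_univ_two, RCLike.inner_apply, conj_trivial] at this
    rw [show ξ 0 * ζ 0 + ξ 1 * ζ 1 = 0 by linarith, zero_mul]

theorem elasticRayTransform2_eq_zero_of_potentials {N : ℕ∞} (hN : 1 ≤ N) (f : SchwartzElastic2 2)
    (v : SmoothElastic1 2) (u : SchwartzVectorField 2)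
    (hf : ∀ i j k l x, f.comp i j k l x =
      opH v.comp i j k l x + opK (fun a => ⇑(u a)) i j k l x)
    (hv : ∀ i j, VanishesAtInfinity N (v.comp i j)) :
    elasticRayTransform2 f = 0 := by
  funext ⟨x, ⟨⟨ξ, ζ⟩, h⟩⟩
  have hξ : ‖ξ‖ = 1 := h.1
  -- Primitive of the integrand: the two halves of `opH` contract to the same sum, with one
  -- derivative along ξ to integrate.
  set B : ℝ → ℝ := fun t =>
    (∑ j, ∑ k, ∑ l, (ζ j * ξ k * ζ l) * partialD j (v.comp k l) (x + t • ξ)) +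
    ∑ j, ((ξ 0 * ζ 0 + ξ 1 * ζ 1) * ζ j) * u j (x + t • ξ) with hB
  have hd : ∀ t, HasDerivAt B (∑ i, ∑ j, ∑ k, ∑ l,
      f.comp i j k l (x + t • ξ) * (ξ i * ζ j * ξ k * ζ l)) t := by
    intro t
    have h1 : HasDerivAt B
        ((∑ j, ∑ k, ∑ l, (ζ j * ξ k * ζ l) *
          ∑ i, ξ i * partialD i (partialD j (v.comp k l)) (x + t • ξ)) +
        ∑ j, ((ξ 0 * ζ 0 + ξ 1 * ζ 1) * ζ j) * ∑ i, ξ i * partialD i (u j) (x + t • ξ)) t := by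
      refine HasDerivAt.add ?_ ?_
      · exact HasDerivAt.fun_sum fun j _ => HasDerivAt.fun_sum fun k _ => HasDerivAt.fun_sum
          fun l _ => (hasDerivAt_along_line (differentiable_partialD (v.smooth k l) j) x ξ
            t).const_mul _
      · exact HasDerivAt.fun_sum fun j _ =>
          (hasDerivAt_along_line (u j).differentiable x ξ t).const_mul _
    convert h1 using 1
    have hz := polarizationPairs_mul_eq_zero h
    simp only [hf, opH, opK, Fin.sum_univ_two]
    simp only [if_true, zero_ne_one, one_ne_zero, if_false, Fin.isValue]
    -- The discrepancy is the curl of `u` times the vanishing product.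
    linear_combination (1 / 2) * (partialD 1 (u 0) (x + t • ξ) - partialD 0 (u 1) (x + t • ξ)) * hz
  have hi : Integrable fun t : ℝ => ∑ i, ∑ j, ∑ k, ∑ l,
      f.comp i j k l (x + t • ξ) * (ξ i * ζ j * ξ k * ζ l) :=
    integrable_finsetSum _ fun i _ => integrable_finsetSum _ fun j _ =>
      integrable_finsetSum _ fun k _ => integrable_finsetSum _ fun l _ =>
        ((f.comp i j k l).integrable_along_line x hξ).mul_const _
  have hl : Tendsto B (cocompact ℝ) (𝓝 0) := by
    have h1 : ∀ j k l, Tendsto (fun t : ℝ => (ζ j * ξ k * ζ l) *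
        partialD j (v.comp k l) (x + t • ξ)) (cocompact ℝ) (𝓝 0) := fun j k l => by
      simpa using (((hv k l).tendsto_partialD_zero hN j).comp
        (tendsto_line_cocompact x hξ)).const_mul (ζ j * ξ k * ζ l)
    have h2 : ∀ j, Tendsto (fun t : ℝ => ((ξ 0 * ζ 0 + ξ 1 * ζ 1) * ζ j) * u j (x + t • ξ))
        (cocompact ℝ) (𝓝 0) := fun j => by
      simpa using (((u j).vanishesAtInfinity 0).tendsto_zero.comp
        (tendsto_line_cocompact x hξ)).const_mul ((ξ 0 * ζ 0 + ξ 1 * ζ 1) * ζ j)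
    have h3 := (tendsto_finsetSum Finset.univ fun j _ => tendsto_finsetSum Finset.univ fun k _ =>
      tendsto_finsetSum Finset.univ fun l _ => h1 j k l).add
      (tendsto_finsetSum Finset.univ fun j _ => h2 j)
    simp only [Finset.sum_const_zero, add_zero] at h3
    exact h3
  rw [cocompact_eq_atBot_atTop, tendsto_sup] at hl
  have := integral_of_hasDerivAt_of_tendsto hd hi hl.1 hl.2
  simpa [elasticRayTransform2] using this

/-! ### From Fourier symbols back to real fields -/

/-- A real Schwartz function regarded as a complex one. -/
def SchwartzMap.complexify {n : ℕ} (g : 𝓢(Euc n, ℝ)) : 𝓢(Euc n, ℂ) :=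
  g.postcompCLM Complex.ofRealCLM

theorem SchwartzMap.complexify_apply {n : ℕ} (g : 𝓢(Euc n, ℝ)) (x : Euc n) :
    g.complexify x = (g x : ℂ) := rfl

/-- The real part of a complex Schwartz function. -/
def SchwartzMap.rePart {n : ℕ} (g : 𝓢(Euc n, ℂ)) : 𝓢(Euc n, ℝ) :=
  g.postcompCLM Complex.reCLM

theorem SchwartzMap.rePart_apply {n : ℕ} (g : 𝓢(Euc n, ℂ)) (x : Euc n) :
    g.rePart x = (g x).re := rfl

theorem SchwartzMap.partialD_rePart {n : ℕ} (i : Fin n) (g : 𝓢(Euc n, ℂ)) :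
    partialD i g.rePart = (∂_{EuclideanSpace.single i (1 : ℝ)} g).rePart := by
  funext x
  have h := Complex.reCLM.hasFDerivAt.comp x (g.hasFDerivAt x)
  have h' : HasFDerivAt g.rePart (Complex.reCLM.comp (fderiv ℝ g x)) x := h
  rw [partialD, h'.fderiv, rePart_apply, lineDerivOp_apply_eq_fderiv]
  rfl

theorem SchwartzMap.fourier_lineDeriv_single_apply {n : ℕ} (i : Fin n) (g : 𝓢(Euc n, ℂ))
    (k : Euc n) : 𝓕 (∂_{EuclideanSpace.single i (1 : ℝ)} g) k =
      2 * Real.pi * Complex.I * (k i * 𝓕 g k) := by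
  have ht : (fun x : Euc n => inner ℝ x (EuclideanSpace.single i (1 : ℝ))).HasTemperateGrowth :=
    ((innerSL ℝ).flip (EuclideanSpace.single i (1 : ℝ))).hasTemperateGrowth
  rw [fourier_lineDerivOp_eq, smul_apply, smulLeftCLM_apply_apply ht]
  simp [EuclideanSpace.inner_single_right]

theorem SchwartzMap.eq_of_fourier_apply_eq {n : ℕ} {g h : 𝓢(Euc n, ℂ)}
    (H : ∀ k, 𝓕 g k = 𝓕 h k) : g = h := by
  have : 𝓕 g = 𝓕 h := SchwartzMap.ext H
  simpa using congrArg (fun w : 𝓢(Euc n, ℂ) => (𝓕⁻ w : 𝓢(Euc n, ℂ))) this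

/-- A field whose Fourier transform has the symbol form of `Hv + Ku` is of the form `Hv + Ku`. -/
theorem exists_potentials_of_fourier_eq {n : ℕ} (f : SchwartzElastic2 n)
    (V : Fin n → Fin n → 𝓢(Euc n, ℂ)) (U : Fin n → 𝓢(Euc n, ℂ)) (hV : ∀ i j, V i j = V j i)
    (h : ∀ i j k l (κ : Euc n), 𝓕 (f.comp i j k l).complexify κ =
      1 / 2 * (κ i * κ j * V k l κ + κ k * κ l * V i j κ) +
      1 / 4 * (κ i * U j κ + κ j * U i κ) * (if k = l then 1 else 0) +
      1 / 4 * (κ k * U l κ + κ l * U k κ) * (if i = j then 1 else 0)) :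
    ∃ (v : Fin n → Fin n → 𝓢(Euc n, ℝ)) (u : SchwartzVectorField n), (∀ i j, v i j = v j i) ∧
      ∀ i j k l x, f.comp i j k l x =
        opH (fun i j => ⇑(v i j)) i j k l x + opK (fun a => ⇑(u a)) i j k l x := by
  -- Each derivative contributes 2πi on the Fourier side, so `V` (second order) is scaled by c² and
  -- `U` (first order) by c.
  set c : ℂ := (2 * Real.pi * Complex.I)⁻¹ with hc
  have hc0 : c * (2 * Real.pi * Complex.I) = 1 :=
    inv_mul_cancel₀ Complex.two_pi_I_ne_zero
  set v' : Fin n → Fin n → 𝓢(Euc n, ℂ) := fun i j => 𝓕⁻ (c ^ 2 • V i j) with hv'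
  set u' : Fin n → 𝓢(Euc n, ℂ) := fun i => 𝓕⁻ (c • U i) with hu'
  have fv : ∀ i j κ, 𝓕 (v' i j) κ = c ^ 2 * V i j κ := fun i j κ => by
    rw [hv', FourierTransform.fourier_fourierInv_eq]; rfl
  have fu : ∀ i κ, 𝓕 (u' i) κ = c * U i κ := fun i κ => by
    rw [hu', FourierTransform.fourier_fourierInv_eq]; rfl
  refine ⟨fun i j => (v' i j).rePart, fun i => (u' i).rePart, fun i j => by
    simp only [hv', hV i j], fun i j k l x => ?_⟩
  let e : Fin n → Euc n := fun i => EuclideanSpace.single i 1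
  have key : (f.comp i j k l).complexify =
      (1 / 2 : ℂ) • (∂_{e i} (∂_{e j} (v' k l)) + ∂_{e k} (∂_{e l} (v' i j))) +
      ((1 / 4 : ℂ) * (if k = l then 1 else 0)) • (∂_{e i} (u' j) + ∂_{e j} (u' i)) +
      ((1 / 4 : ℂ) * (if i = j then 1 else 0)) • (∂_{e k} (u' l) + ∂_{e l} (u' k)) := by
    refine SchwartzMap.eq_of_fourier_apply_eq fun κ => ?_
    simp only [FourierTransform.fourier_add, FourierTransform.fourier_smul, add_apply, smul_apply,
      smul_eq_mul, e, SchwartzMap.fourier_lineDeriv_single_apply, fv, fu]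
    rw [h]
    generalize (2 * Real.pi * Complex.I : ℂ) = w at hc0
    generalize (if k = l then (1 : ℂ) else 0) = δ₁
    generalize (if i = j then (1 : ℂ) else 0) = δ₂
    have hc2 : c ^ 2 * w ^ 2 = 1 := by rw [← mul_pow, hc0, one_pow]
    linear_combination (-1 / 2 * (κ i * κ j * V k l κ + κ k * κ l * V i j κ)) * hc2 -
      (1 / 4 * (κ i * U j κ + κ j * U i κ) * δ₁ + 1 / 4 * (κ k * U l κ + κ l * U k κ) * δ₂) * hc0
  -- Since `f` is real and both operators have real coefficients, the real parts of the potentials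
  -- suffice.
  have := congrArg (fun g : 𝓢(Euc n, ℂ) => (g x).re) key
  simp only [SchwartzMap.complexify_apply, Complex.ofReal_re] at this
  rw [this]
  simp only [opH, opK, SchwartzMap.partialD_rePart, SchwartzMap.rePart_apply, add_apply,
    smul_apply, smul_eq_mul, e]
  split_ifs <;> (simp; try ring)

/-- On the Fourier side, the kernel condition for the elastic ray transform. -/
theorem sum_fourier_eq_zero_of_elasticRayTransform2_eq_zero {n : ℕ} (f : SchwartzElastic2 n)
    (hf : elasticRayTransform2 f = 0) {ξ ζ k : Euc n} (h : (ξ, ζ) ∈ polarizationPairs n)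
    (hk : inner ℝ ξ k = 0) :
    ∑ i, ∑ j, ∑ m, ∑ l, ((ξ i * ζ j * ξ m * ζ l : ℝ) : ℂ) *
      𝓕 (f.comp i j m l).complexify k = 0 := by
  set g : 𝓢(Euc n, ℂ) := ∑ i, ∑ j, ∑ m, ∑ l,
    ((ξ i * ζ j * ξ m * ζ l : ℝ) : ℂ) • (f.comp i j m l).complexify with hg
  have hgx : ∀ x, g x = ((∑ i, ∑ j, ∑ m, ∑ l,
      f.comp i j m l x * (ξ i * ζ j * ξ m * ζ l) : ℝ) : ℂ) := fun x => by
    simp only [hg, sum_apply, smul_apply, SchwartzMap.complexify_apply, smul_eq_mul,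
      Complex.ofReal_sum, Complex.ofReal_mul]
    refine Finset.sum_congr rfl fun i _ => Finset.sum_congr rfl fun j _ =>
      Finset.sum_congr rfl fun m _ => Finset.sum_congr rfl fun l _ => mul_comm _ _
  have h0 : 𝓕 g k = 0 := by
    refine fourier_eq_zero_of_line_integrals g ξ k h.1 hk fun x => ?_
    have := congrFun hf (x, ⟨(ξ, ζ), h⟩)
    simp only [elasticRayTransform2, Pi.zero_apply] at this
    simp only [hgx]
    rw [integral_complex_ofReal, this, Complex.ofReal_zero]
  rw [← h0, hg, ← SchwartzMap.fourierTransformCLM_apply ℂ]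
  simp only [map_sum, map_smul, sum_apply, smul_apply, smul_eq_mul,
    SchwartzMap.fourierTransformCLM_apply]

/-! ### The planar kernel -/

/-- Rotation by a right angle in the plane. -/
def rot (k : Euc 2) : Euc 2 := !₂[-k 1, k 0]

theorem inner_rot (k : Euc 2) : inner ℝ (rot k) k = 0 := by
  simp [rot, PiLp.inner_apply, Fin.sum_univ_two]; ring

theorem norm_rot (k : Euc 2) : ‖rot k‖ = ‖k‖ := by
  simp [rot, EuclideanSpace.norm_eq, Fin.sum_univ_two]; ring_nf

theorem inv_norm_smul_rot_mem_polarizationPairs {k ζ : Euc 2} (hk : k ≠ 0)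
    (hζ : ζ ∈ Submodule.span ℝ {rot k} ∨ ζ ∈ Submodule.span ℝ {k}) :
    (‖k‖⁻¹ • rot k, ζ) ∈ polarizationPairs 2 := by
  have hk' : ‖k‖ ≠ 0 := norm_ne_zero_iff.2 hk
  refine ⟨by simp [norm_smul, norm_rot, hk'], hζ.imp (fun h => ?_) fun h => ?_⟩
  · rwa [Submodule.span_singleton_smul_eq (inv_ne_zero hk').isUnit]
  · rw [Submodule.mem_orthogonal_singleton_iff_inner_right]
    obtain ⟨c, rfl⟩ := Submodule.mem_span_singleton.1 h
    simp [inner_smul_left, inner_smul_right, inner_rot]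

theorem exists_potentials_of_elasticRayTransform2_eq_zero (f : SchwartzElastic2 2)
    (hf : elasticRayTransform2 f = 0) :
    ∃ (v : Fin 2 → Fin 2 → 𝓢(Euc 2, ℝ)) (u : SchwartzVectorField 2), (∀ i j, v i j = v j i) ∧
      ∀ i j k l x, f.comp i j k l x =
        opH (fun i j => ⇑(v i j)) i j k l x + opK (fun a => ⇑(u a)) i j k l x := by
  have s0010 : f.comp 0 0 1 0 = f.comp 0 0 0 1 := f.symm_right _ _ _ _
  have s0100 : f.comp 0 1 0 0 = f.comp 0 0 0 1 := f.symm_block _ _ _ _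
  have s1000 : f.comp 1 0 0 0 = f.comp 0 0 0 1 := (f.symm_left _ _ _ _).trans s0100
  have s0110 : f.comp 0 1 1 0 = f.comp 0 1 0 1 := f.symm_right _ _ _ _
  have s1001 : f.comp 1 0 0 1 = f.comp 0 1 0 1 := f.symm_left _ _ _ _
  have s1010 : f.comp 1 0 1 0 = f.comp 0 1 0 1 := (f.symm_left _ _ _ _).trans s0110
  have s1100 : f.comp 1 1 0 0 = f.comp 0 0 1 1 := f.symm_block _ _ _ _
  have s1011 : f.comp 1 0 1 1 = f.comp 0 1 1 1 := f.symm_left _ _ _ _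
  have s1101 : f.comp 1 1 0 1 = f.comp 0 1 1 1 := f.symm_block _ _ _ _
  have s1110 : f.comp 1 1 1 0 = f.comp 0 1 1 1 := (f.symm_right _ _ _ _).trans s1101
  have hsum : ∀ {k ζ : Euc 2}, k ≠ 0 →
      (ζ ∈ Submodule.span ℝ {rot k} ∨ ζ ∈ Submodule.span ℝ {k}) →
      ∑ i, ∑ j, ∑ m, ∑ l, ((rot k i * ζ j * rot k m * ζ l : ℝ) : ℂ) *
        𝓕 (f.comp i j m l).complexify k = 0 := by
    intro k ζ hk hζ
    have h := sum_fourier_eq_zero_of_elasticRayTransform2_eq_zero f hf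
      (inv_norm_smul_rot_mem_polarizationPairs hk hζ)
      (k := k) (by rw [inner_smul_left, inner_rot, mul_zero])
    -- The contraction is quadratic in ξ, so normalising ξ costs only this factor, and cancelling it
    -- leaves relations polynomial in k.
    have hk' : ((‖k‖⁻¹ : ℝ) : ℂ) ^ 2 ≠ 0 := by
      simpa using hk
    refine (mul_eq_zero.1 (?_ : ((‖k‖⁻¹ : ℝ) : ℂ) ^ 2 * _ = 0)).resolve_left hk'
    rw [← h]
    simp only [Finset.mul_sum]
    refine Finset.sum_congr rfl fun i _ => Finset.sum_congr rfl fun j _ =>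
      Finset.sum_congr rfl fun m _ => Finset.sum_congr rfl fun l _ => ?_
    simp only [PiLp.smul_apply, smul_eq_mul]
    push_cast
    ring
  have r0 : ∀ k, rot k 0 = -k 1 := fun _ => rfl
  have r1 : ∀ k, rot k 1 = k 0 := fun _ => rfl
  obtain ⟨U₀, U₁, T, V, h⟩ := exists_potentials_of_symbol_eq
    (𝓕 (f.comp 0 0 0 0).complexify) (𝓕 (f.comp 0 0 0 1).complexify)
    (𝓕 (f.comp 0 0 1 1).complexify) (𝓕 (f.comp 0 1 0 1).complexify)
    (𝓕 (f.comp 0 1 1 1).complexify) (𝓕 (f.comp 1 1 1 1).complexify)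
    (fun k => by
      by_cases hk : k = 0
      · simp [hk]
      have := hsum hk (Or.inl (Submodule.mem_span_singleton_self _))
      simp only [Fin.sum_univ_two, r0, r1, s0010, s0100, s1000, s0110, s1001, s1010, s1100, s1011,
        s1101, s1110] at this
      push_cast at this
      linear_combination this)
    (fun k => by
      by_cases hk : k = 0
      · simp [hk]
      have := hsum hk (Or.inr (Submodule.mem_span_singleton_self _))
      simp only [Fin.sum_univ_two, r0, r1, s0010, s0100, s1000, s0110, s1001, s1010, s1100, s1011,
        s1101, s1110] at this
      push_cast at this
      linear_combination this)
  -- Taking v₀₀ = 0 loses nothing: `Hv + Ku` is unchanged when φδ is added to v and ∇φ is subtracted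
  -- from u.
  refine exists_potentials_of_fourier_eq f ![![0, T], ![T, V]] ![U₀, U₁] ?_ ?_
  · intro i j
    fin_cases i <;> fin_cases j <;> rfl
  · intro i j k l κ
    obtain ⟨h1, h2, h3, h4, h5, h6⟩ := h κ
    fin_cases i <;> fin_cases j <;> fin_cases k <;> fin_cases l <;>
      (simp only [Fin.zero_eta, Fin.mk_one, Fin.isValue, s0010, s0100, s1000, s0110, s1001, s1010,
        s1100, s1011, s1101, s1110, h1, h2, h3, h4, h5, h6, Matrix.cons_val_zero,
        Matrix.cons_val_one, if_true, zero_ne_one, one_ne_zero, if_false, zero_apply]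
       ring)

theorem mainTheorem3 (N : ℕ∞) (hN : 1 ≤ N) (f : SchwartzElastic2 2) :
    elasticRayTransform2 f = 0 ↔
      ∃ (v : SmoothElastic1 2) (u : SchwartzVectorField 2),
        (∀ i j k l x, f.comp i j k l x =
          opH v.comp i j k l x + opK (fun a => ⇑(u a)) i j k l x) ∧
        (∀ i j, VanishesAtInfinity N (v.comp i j)) ∧
        (∀ i, VanishesAtInfinity N (u i)) := by
  constructor
  · intro hf
    obtain ⟨v, u, hv, h⟩ := exists_potentials_of_elasticRayTransform2_eq_zero f hf
    exact ⟨⟨fun i j => v i j, fun i j => (v i j).smooth _, fun i j => by rw [hv i j]⟩, u, h,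
      fun i j => (v i j).vanishesAtInfinity N, fun i => (u i).vanishesAtInfinity N⟩
  · rintro ⟨v, u, h, hv, -⟩
    exact elasticRayTransform2_eq_zero_of_potentials hN f v u h hv

end
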